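/- All Hilbert spaces are finite-dimensional and complex, and $\log$ is taken to base $2$. For a density operator $\rho$ let $S(\rho)=-\operatorname{Tr}\rho\log\rho$ be the von Neumann entropy, and for a state $\rho^{ABE}$ let $I(A;B|E)=S(AE)+S(BE)-S(ABE)-S(E)$, where $S(X)$ is the entropy of the reduced state on $X$. The squashed entanglement of a state $\rho^{AB}$ on $\mathcal H_A\otimes\mathcal H_B$ is $$E_{sq}(\rho^{AB})=\inf\bigl\{\tfrac12 I(A;B|E)\;:\;\rho^{ABE}\text{ a state on }\mathcal H_A\otimes\mathcal H_B\otimes\mathcal H_E,\ \operatorname{Tr}_E\rho^{ABE}=\rho^{AB}\bigr\},$$ where the dimension of $\mathcal H_E$ is finite but arbitrary. This infimum is a well-defined real number for every state $\rho^{AB}$, and the following hold. 1. (Strong superadditivity) For every state $\rho^{AA'BB'}$ on $\mathcal H_A\otimes\mathcal H_{A'}\otimes\mathcal H_B\otimes\mathcal H_{B'}$, regarded as bipartite across $AA':BB'$, with marginals $\rho^{AB}=\operatorname{Tr}_{A'B'}\rho^{AA'BB'}$ and $\rho^{A'B'}=\operatorname{Tr}_{AB}\rho^{AA'BB'}$,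 $$E_{sq}(\rho^{AA'BB'})\ge E_{sq}(\rho^{AB})+E_{sq}(\rho^{A'B'}).$$ 2. (Subadditivity) For all states $\rho^{AB}$ and $\sigma^{A'B'}$, with $\rho^{AB}\otimes\sigma^{A'B'}$ regarded as bipartite across $AA':BB'$, $$E_{sq}(\rho^{AB}\otimes\sigma^{A'B'})\le E_{sq}(\rho^{AB})+E_{sq}(\sigma^{A'B'}).$$ 3. (Additivity) For all states $\rho^{AB}$ and $\sigma^{A'B'}$, $$E_{sq}(\rho^{AB}\otimes\sigma^{A'B'})=E_{sq}(\rho^{AB})+E_{sq}(\sigma^{A'B'}).$$ 4. (Extensivity) For every state $\rho^{AB}$ and every integer $n\ge1$, with $(\rho^{AB})^{\otimes n}$ regarded as bipartite across $A^n:B^n$, $$E_{sq}(\rho^{AB})=\frac{E_{sq}\bigl((\rho^{AB})^{\otimes n}\bigr)}{n}.$$ 5. (Regularisation) For every state $\rho^{AB}$ the limit $E_{sq}^\infty(\rho^{AB})=\lim_{n\to\infty}\frac1n E_{sq}\bigl((\rho^{AB})^{\otimes n}\bigr)$ exists and equals $E_{sq}(\rho^{AB})$. -/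

import Mathlib

open scoped Kronecker ComplexOrder

/-- A quantum state (density matrix) on the Hilbert space `ℂ^n`: a positive semidefinite matrix
of trace one. -/
def IsState {n : Type*} [Fintype n] (ρ : Matrix n n ℂ) : Prop :=
  ρ.PosSemidef ∧ ρ.trace = 1

/-- The von Neumann entropy `S(ρ) = -Tr ρ log₂ ρ`. The logarithm of the Hermitian matrix `ρ` is
taken through the functional calculus; as `Real.logb 2 0 = 0`, the eigenvalue `0` contributes `0`. -/
noncomputable def vonNeumannEntropy {n : Type*} [Fintype n] [DecidableEq n]
    (ρ : Matrix n n ℂ) : ℝ :=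
  -(Matrix.trace (ρ * cfc (Real.logb 2) ρ)).re

/-- The partial trace over the second tensor factor. -/
def traceRight {m n : Type*} [Fintype n] (M : Matrix (m × n) (m × n) ℂ) : Matrix m m ℂ :=
  Matrix.of fun i i' => ∑ k, M (i, k) (i', k)

/-- The partial trace over the first tensor factor. -/
def traceLeft {m n : Type*} [Fintype m] (M : Matrix (m × n) (m × n) ℂ) : Matrix n n ℂ :=
  Matrix.of fun k k' => ∑ i, M (i, k) (i, k')

/-- The marginal on `AE` of a tripartite matrix on `ABE`. -/
def marginalAE {a b e : Type*} [Fintype b] (M : Matrix ((a × b) × e) ((a × b) × e) ℂ) :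
    Matrix (a × e) (a × e) ℂ :=
  Matrix.of fun x y => ∑ j, M ((x.1, j), x.2) ((y.1, j), y.2)

/-- The marginal on `BE` of a tripartite matrix on `ABE`. -/
def marginalBE {a b e : Type*} [Fintype a] (M : Matrix ((a × b) × e) ((a × b) × e) ℂ) :
    Matrix (b × e) (b × e) ℂ :=
  Matrix.of fun x y => ∑ i, M ((i, x.1), x.2) ((i, y.1), y.2)

/-- The quantum conditional mutual information `I(A;B|E) = S(AE) + S(BE) - S(ABE) - S(E)`. -/
noncomputable def condMutualInfo {a b e : Type*} [Fintype a] [DecidableEq a] [Fintype b]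
    [DecidableEq b] [Fintype e] [DecidableEq e] (M : Matrix ((a × b) × e) ((a × b) × e) ℂ) : ℝ :=
  vonNeumannEntropy (marginalAE M) + vonNeumannEntropy (marginalBE M)
    - vonNeumannEntropy M - vonNeumannEntropy (traceLeft M)

/-- `σ` is an extension of the bipartite matrix `ρ`: a state on `ABE` with `Tr_E σ = ρ`. -/
def IsExtension {a b e : Type*} [Fintype a] [Fintype b] [Fintype e]
    (ρ : Matrix (a × b) (a × b) ℂ) (σ : Matrix ((a × b) × e) ((a × b) × e) ℂ) : Prop :=
  IsState σ ∧ traceRight σ = ρ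

/-- The values `½ I(A;B|E)` over all extensions of `ρ` by a system `E = ℂ^d` of arbitrary finite
dimension `d`. -/
def squashedValues {a b : Type*} [Fintype a] [DecidableEq a] [Fintype b] [DecidableEq b]
    (ρ : Matrix (a × b) (a × b) ℂ) : Set ℝ :=
  {x | ∃ (d : ℕ) (σ : Matrix ((a × b) × Fin d) ((a × b) × Fin d) ℂ),
    IsExtension ρ σ ∧ x = (1 / 2 : ℝ) * condMutualInfo σ}

/-- The squashed entanglement `E_sq(ρ) = inf ½ I(A;B|E)` across the cut `A : B`. -/
noncomputable def squashedEntanglement {a b : Type*} [Fintype a] [DecidableEq a] [Fintype b]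
    [DecidableEq b] (ρ : Matrix (a × b) (a × b) ℂ) : ℝ :=
  sInf (squashedValues ρ)

/-- The marginal on `AB` of a matrix on `AA'BB'`. -/
def marginalAB {a a' b b' : Type*} [Fintype a'] [Fintype b']
    (M : Matrix ((a × a') × (b × b')) ((a × a') × (b × b')) ℂ) : Matrix (a × b) (a × b) ℂ :=
  Matrix.of fun x y => ∑ i : a', ∑ j : b', M ((x.1, i), (x.2, j)) ((y.1, i), (y.2, j))

/-- The marginal on `A'B'` of a matrix on `AA'BB'`. -/
def marginalPrimed {a a' b b' : Type*} [Fintype a] [Fintype b]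
    (M : Matrix ((a × a') × (b × b')) ((a × a') × (b × b')) ℂ) : Matrix (a' × b') (a' × b') ℂ :=
  Matrix.of fun x y => ∑ i : a, ∑ j : b, M ((i, x.1), (j, x.2)) ((i, y.1), (j, y.2))

/-- The tensor product `ρ^{AB} ⊗ σ^{A'B'}`, as a bipartite matrix across the cut `AA' : BB'`. -/
def bipartiteTensor {a a' b b' : Type*} (ρ : Matrix (a × b) (a × b) ℂ)
    (σ : Matrix (a' × b') (a' × b') ℂ) :
    Matrix ((a × a') × (b × b')) ((a × a') × (b × b')) ℂ :=
  (ρ ⊗ₖ σ).submatrix (Equiv.prodProdProdComm a a' b b') (Equiv.prodProdProdComm a a' b b')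

/-- The tensor power `ρ^{⊗n}`, as a bipartite matrix across the cut `A^n : B^n`. -/
def bipartiteTensorPower {a b : Type*} (ρ : Matrix (a × b) (a × b) ℂ) (n : ℕ) :
    Matrix ((Fin n → a) × (Fin n → b)) ((Fin n → a) × (Fin n → b)) ℂ :=
  Matrix.of fun x y => ∏ k, ρ (x.1 k, x.2 k) (y.1 k, y.2 k)

/-! The engine is strong subadditivity, `0 ≤ I(A;B|E)`, obtained from monotonicity of relative
entropy under partial trace: compare `ρ^{ABE}` with `1_A ⊗ ρ^{BE}` and trace out `B`.

For monotonicity, write `Tr ρ (log ρ - log σ)` as `∑ w (log p - log q)` over pairs of eigenvalues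
`p` of `ρ` and `q` of `σ`, where `w` is `p` times the squared overlap of the eigenvectors. This is
the growth of `t ↦ ∑ w log (q + t p)` from `0` to infinity, up to a term `log t` depending only on
`∑ w = Tr ρ`. The derivative `∑ w p / (q + t p)` is the maximum over `X` of `resolventForm t ρ σ X`.
The form of the marginals at `X` is that of the full matrices at `X ⊗ 1`, so passing to marginals
only shrinks the maximum.

Strong subadditivity bounds the infimum below by `0`. Superadditivity is the chain rule
`I(AA';BB'|E) = I(A;B|E) + I(A';B|AE) + I(A;B'|BE) + I(A';B'|ABE)`: the two middle terms are
nonnegative, and the outer two come from extensions of the marginals by `E` and by `ABE`.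
Subadditivity uses tensor products of extensions. Together they give additivity, and induction gives
`n` copies and the regularisation. -/

open Matrix

/-! ### Unitary diagonalizations -/

/-- A diagonalization `ρ = U diag(p) U†` of a matrix by a unitary matrix, with real diagonal. -/
structure UnitaryDiag {n : Type*} [Fintype n] [DecidableEq n] (U : Matrix n n ℂ) (p : n → ℝ)
    (ρ : Matrix n n ℂ) : Prop where
  conj_mul : Uᴴ * U = 1
  mul_conj : U * Uᴴ = 1
  eq : ρ = U * diagonal (fun i => (p i : ℂ)) * Uᴴ

namespace UnitaryDiag

variable {n m : Type*} [Fintype n] [DecidableEq n] [Fintype m] [DecidableEq m]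
  {U : Matrix n n ℂ} {p : n → ℝ} {ρ : Matrix n n ℂ}

theorem exists_of_isHermitian (hρ : ρ.IsHermitian) : ∃ U p, UnitaryDiag U p ρ := by
  refine ⟨hρ.eigenvectorUnitary, hρ.eigenvalues, ?_, ?_, ?_⟩
  · exact Unitary.coe_star_mul_self hρ.eigenvectorUnitary
  · exact Unitary.coe_mul_star_self hρ.eigenvectorUnitary
  · exact hρ.spectral_theorem

theorem isHermitian (h : UnitaryDiag U p ρ) : ρ.IsHermitian := by
  rw [h.eq, Matrix.IsHermitian, conjTranspose_mul, conjTranspose_mul, conjTranspose_conjTranspose,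
    diagonal_conjTranspose, mul_assoc]
  congr!
  simp

theorem diag_eq (h : UnitaryDiag U p ρ) : Uᴴ * ρ * U = diagonal (fun i => (p i : ℂ)) := by
  rw [h.eq, show Uᴴ * (U * diagonal (fun i => (p i : ℂ)) * Uᴴ) * U
    = (Uᴴ * U) * diagonal (fun i => (p i : ℂ)) * (Uᴴ * U) by simp only [mul_assoc],
    h.conj_mul, one_mul, mul_one]

theorem nonneg (h : UnitaryDiag U p ρ) (hρ : ρ.PosSemidef) (i : n) : 0 ≤ p i := by
  have h1 := (hρ.conjTranspose_mul_mul_same U).diag_nonneg (i := i)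
  rw [h.diag_eq, diagonal_apply_eq] at h1
  exact_mod_cast h1

theorem trace_eq (h : UnitaryDiag U p ρ) : ρ.trace = ((∑ i, p i : ℝ) : ℂ) := by
  rw [h.eq, trace_mul_comm, ← mul_assoc, h.conj_mul, one_mul, trace_diagonal]
  push_cast; rfl

theorem one : UnitaryDiag (1 : Matrix n n ℂ) (fun _ => 1) 1 :=
  ⟨by simp, by simp, by simp⟩

theorem kronecker (h : UnitaryDiag U p ρ) {V : Matrix m m ℂ} {q : m → ℝ} {σ : Matrix m m ℂ}
    (h' : UnitaryDiag V q σ) :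
    UnitaryDiag (U ⊗ₖ V) (fun x => p x.1 * q x.2) (ρ ⊗ₖ σ) := by
  refine ⟨?_, ?_, ?_⟩
  · rw [conjTranspose_kronecker, ← mul_kronecker_mul, h.conj_mul, h'.conj_mul, one_kronecker_one]
  · rw [conjTranspose_kronecker, ← mul_kronecker_mul, h.mul_conj, h'.mul_conj, one_kronecker_one]
  · rw [h.eq, h'.eq, mul_kronecker_mul, mul_kronecker_mul, conjTranspose_kronecker,
      diagonal_kronecker_diagonal]
    simp

theorem submatrix (h : UnitaryDiag U p ρ) (e : m ≃ n) :
    UnitaryDiag (U.submatrix e e) (p ∘ e) (ρ.submatrix e e) := by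
  refine ⟨?_, ?_, ?_⟩
  · rw [conjTranspose_submatrix, submatrix_mul_equiv, h.conj_mul, submatrix_one_equiv]
  · rw [conjTranspose_submatrix, submatrix_mul_equiv, h.mul_conj, submatrix_one_equiv]
  · have : diagonal (fun i => ((p ∘ e) i : ℂ))
        = (diagonal (fun i => (p i : ℂ))).submatrix e e := by
      rw [submatrix_diagonal_equiv]; rfl
    rw [this, conjTranspose_submatrix, submatrix_mul_equiv, submatrix_mul_equiv, ← h.eq]

/-- The characteristic polynomial determines the multiset of eigenvalues, so spectral sums may be
computed in any diagonalization, in particular in product bases. -/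
theorem sum_eigenvalues (h : UnitaryDiag U p ρ) (f : ℝ → ℝ) :
    ∑ i, f (h.isHermitian.eigenvalues i) = ∑ i, f (p i) := by
  have h1 := h.isHermitian.roots_charpoly_eq_eigenvalues
  have h2 : ρ.charpoly = ∏ i, (Polynomial.X - Polynomial.C (p i : ℂ)) := by
    conv_lhs => rw [h.eq]
    rw [charpoly_mul_comm, ← mul_assoc, h.conj_mul, one_mul, charpoly_diagonal]
  have h4 : ∏ i, (Polynomial.X - Polynomial.C (p i : ℂ))
      = ((Finset.univ.val.map fun i => (p i : ℂ)).map fun z => Polynomial.X - Polynomial.C z).prod := by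
    rw [Multiset.map_map]; rfl
  rw [h2, h4, Polynomial.roots_multiset_prod_X_sub_C] at h1
  have h3 := congrArg (fun s : Multiset ℂ => (s.map (fun z => f z.re)).sum) h1
  simp only [Multiset.map_map, Function.comp_def] at h3
  simpa using h3.symm

theorem entropy_eq (h : UnitaryDiag U p ρ) :
    vonNeumannEntropy ρ = -∑ i, p i * Real.logb 2 (p i) := by
  rw [← h.sum_eigenvalues (fun x => x * Real.logb 2 x), vonNeumannEntropy]
  set hA := h.isHermitian
  rw [hA.cfc_eq, Matrix.IsHermitian.cfc]
  conv_lhs => enter [1, 1, 1, 1]; rw [hA.spectral_theorem]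
  rw [← map_mul, diagonal_mul_diagonal, Unitary.conjStarAlgAut_apply, trace_mul_comm, ← mul_assoc,
    Unitary.coe_star_mul_self, one_mul, trace_diagonal]
  simp

end UnitaryDiag

/-! ### Entropy under relabelling and tensor products -/

section Entropy

variable {n m : Type*} [Fintype n] [DecidableEq n] [Fintype m] [DecidableEq m]

theorem vonNeumannEntropy_submatrix {ρ : Matrix n n ℂ} (hρ : ρ.IsHermitian) (e : m ≃ n) :
    vonNeumannEntropy (ρ.submatrix e e) = vonNeumannEntropy ρ := by
  obtain ⟨U, p, h⟩ := UnitaryDiag.exists_of_isHermitian hρ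
  rw [h.entropy_eq, (h.submatrix e).entropy_eq]
  congr 1
  exact e.sum_comp (fun i => p i * Real.logb 2 (p i))

theorem vonNeumannEntropy_kronecker {ρ : Matrix n n ℂ} {σ : Matrix m m ℂ} (hρ : IsState ρ)
    (hσ : IsState σ) :
    vonNeumannEntropy (ρ ⊗ₖ σ) = vonNeumannEntropy ρ + vonNeumannEntropy σ := by
  obtain ⟨U, p, h⟩ := UnitaryDiag.exists_of_isHermitian hρ.1.isHermitian
  obtain ⟨V, q, h'⟩ := UnitaryDiag.exists_of_isHermitian hσ.1.isHermitian
  have hp : ∑ i, p i = 1 := by exact_mod_cast h.trace_eq.symm.trans hρ.2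
  have hq : ∑ i, q i = 1 := by exact_mod_cast h'.trace_eq.symm.trans hσ.2
  rw [h.entropy_eq, h'.entropy_eq, (h.kronecker h').entropy_eq, Fintype.sum_prod_type, ← neg_add]
  congr 1
  -- Zero eigenvalues are treated separately: there the logarithm of the product does not split, but
  -- both sides vanish.
  have key : ∀ i j, p i * q j * Real.logb 2 (p i * q j)
      = p i * Real.logb 2 (p i) * q j + p i * (q j * Real.logb 2 (q j)) := by
    intro i j
    by_cases hi : p i = 0
    · simp [hi]
    by_cases hj : q j = 0
    · simp [hj]
    rw [Real.logb_mul hi hj]; ring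
  simp only [key, Finset.sum_add_distrib, ← Finset.mul_sum, ← Finset.sum_mul, hp, hq, one_mul,
    mul_one]

end Entropy

/-! ### Comparing logarithmic sums through their derivatives -/

theorem hasDerivAt_sum_mul_log {ι : Type*} [Fintype ι] {w p q : ι → ℝ}
    (hpq : ∀ i, w i ≠ 0 → 0 < p i ∧ 0 < q i) {t : ℝ} (ht : 0 ≤ t) :
    HasDerivAt (fun t => ∑ i, w i * Real.log (q i + t * p i))
      (∑ i, w i * (p i / (q i + t * p i))) t := by
  refine HasDerivAt.fun_sum fun i _ => ?_
  by_cases hi : w i = 0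
  · simpa [hi] using hasDerivAt_const t (0 : ℝ)
  obtain ⟨h1, h2⟩ := hpq i hi
  have h3 : HasDerivAt (fun t => q i + t * p i) (p i) t := by
    simpa using ((hasDerivAt_id t).mul_const (p i)).const_add (q i)
  exact (h3.log (by positivity)).const_mul (w i)

/-- The substitution `t = 1/s` isolates the divergence at infinity as a multiple of `log s` that
depends only on the total weight. -/
theorem sum_mul_log_add_inv_mul {ι : Type*} [Fintype ι] {w p q : ι → ℝ}
    (hpq : ∀ i, w i ≠ 0 → 0 < p i ∧ 0 < q i) {s : ℝ} (hs : 0 < s) :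
    ∑ i, w i * Real.log (q i + s⁻¹ * p i)
      = (∑ i, w i * Real.log (p i + s * q i)) - (∑ i, w i) * Real.log s := by
  rw [Finset.sum_mul, ← Finset.sum_sub_distrib]
  refine Finset.sum_congr rfl fun i _ => ?_
  by_cases hi : w i = 0
  · simp [hi]
  obtain ⟨h1, h2⟩ := hpq i hi
  rw [← mul_sub, ← Real.log_div (by positivity) hs.ne']
  congr 2
  field_simp
  ring

/-- Comparison of `∑ w (log p - log q)` for two families, from the comparison of the derivatives of
`t ↦ ∑ w log (q + t p)`. -/
theorem sum_mul_log_sub_log_le {ι κ : Type*} [Fintype ι] [Fintype κ] {w p q : ι → ℝ}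
    {w' p' q' : κ → ℝ} (hpq : ∀ i, w i ≠ 0 → 0 < p i ∧ 0 < q i)
    (hpq' : ∀ i, w' i ≠ 0 → 0 < p' i ∧ 0 < q' i) (hw : ∑ i, w i = ∑ i, w' i)
    (hle : ∀ t, 0 < t → ∑ i, w' i * (p' i / (q' i + t * p' i))
      ≤ ∑ i, w i * (p i / (q i + t * p i))) :
    ∑ i, w' i * (Real.log (p' i) - Real.log (q' i))
      ≤ ∑ i, w i * (Real.log (p i) - Real.log (q i)) := by
  set D : ℝ → ℝ := fun t => (∑ i, w i * Real.log (q i + t * p i))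
    - ∑ i, w' i * Real.log (q' i + t * p' i) with hD
  have hder : ∀ t, 0 ≤ t → HasDerivAt D ((∑ i, w i * (p i / (q i + t * p i)))
      - ∑ i, w' i * (p' i / (q' i + t * p' i))) t := fun t ht =>
    (hasDerivAt_sum_mul_log hpq ht).sub (hasDerivAt_sum_mul_log hpq' ht)
  have hmono : MonotoneOn D (Set.Ici 0) := by
    refine monotoneOn_of_deriv_nonneg (convex_Ici 0)
      (fun t ht => (hder t ht).continuousAt.continuousWithinAt) ?_ ?_
    · intro t ht
      rw [interior_Ici] at ht
      exact (hder t (le_of_lt ht)).differentiableAt.differentiableWithinAt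
    · intro t ht
      rw [interior_Ici] at ht
      rw [(hder t (le_of_lt ht)).deriv]
      linarith [hle t ht]
  -- This is the limit of `D (1/s)` as `s → 0⁺`: the two `log s` terms cancel because the total
  -- weights agree.
  have hlim : Filter.Tendsto (fun s : ℝ => (∑ i, w i * Real.log (p i + s * q i))
      - ∑ i, w' i * Real.log (p' i + s * q' i)) (nhdsWithin 0 (Set.Ioi 0))
      (nhds ((∑ i, w i * Real.log (p i + 0 * q i))
        - ∑ i, w' i * Real.log (p' i + 0 * q' i))) := by
    refine Filter.Tendsto.mono_left ?_ nhdsWithin_le_nhds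
    exact ((hasDerivAt_sum_mul_log (fun i hi => (hpq i hi).symm) le_rfl).sub
      (hasDerivAt_sum_mul_log (fun i hi => (hpq' i hi).symm) le_rfl)).continuousAt
  have hfin := ge_of_tendsto hlim (b := D 0) (by
    filter_upwards [self_mem_nhdsWithin] with s hs
    have hs : 0 < s := hs
    have h1 := hmono (Set.mem_Ici.2 le_rfl) (Set.mem_Ici.2 (inv_nonneg.2 hs.le))
      (inv_nonneg.2 hs.le)
    simp only [hD] at h1 ⊢
    rw [sum_mul_log_add_inv_mul hpq hs, sum_mul_log_add_inv_mul hpq' hs, hw] at h1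
    linarith)
  simp only [hD, zero_mul, add_zero] at hfin
  simp only [mul_sub, Finset.sum_sub_distrib]
  linarith

/-! ### Variational formula for the resolvent term -/

/-- The concave quadratic form whose maximum over `X` is the resolvent term in the integral
representation of the relative entropy of `ρ` and `σ`. -/
noncomputable def resolventForm {n : Type*} [Fintype n] (t : ℝ) (ρ σ X : Matrix n n ℂ) : ℝ :=
  2 * (trace (Xᴴ * ρ)).re - (trace (X * Xᴴ * σ)).re - t * (trace (Xᴴ * X * ρ)).re

section Resolvent

variable {n : Type*} [Fintype n] [DecidableEq n] {U V ρ σ : Matrix n n ℂ} {p q : n → ℝ}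

/-- In the eigenbases of `σ` and `ρ` the form decouples into one scalar quadratic for each entry of
`Y`, so it can be maximized entrywise. -/
theorem resolventForm_conj (hρ : UnitaryDiag U p ρ) (hσ : UnitaryDiag V q σ) (t : ℝ)
    (Y : Matrix n n ℂ) :
    resolventForm t ρ σ (V * Y * Uᴴ) = ∑ j, ∑ i,
      (2 * (star (Y j i) * (Vᴴ * U) j i).re * p i - (q j + t * p i) * Complex.normSq (Y j i)) := by
  have h1 : trace ((V * Y * Uᴴ)ᴴ * ρ)
      = trace (Yᴴ * ((Vᴴ * U) * diagonal (fun i => (p i : ℂ)))) := by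
    rw [hρ.eq, conjTranspose_mul, conjTranspose_mul, conjTranspose_conjTranspose,
      show U * (Yᴴ * Vᴴ) * (U * diagonal (fun i => (p i : ℂ)) * Uᴴ)
        = U * (Yᴴ * (Vᴴ * U * diagonal (fun i => (p i : ℂ)))) * Uᴴ by simp only [mul_assoc],
      trace_mul_comm, ← mul_assoc, hρ.conj_mul, one_mul]
  have h2 : trace ((V * Y * Uᴴ) * (V * Y * Uᴴ)ᴴ * σ)
      = trace (Y * Yᴴ * diagonal (fun i => (q i : ℂ))) := by
    rw [hσ.eq, conjTranspose_mul, conjTranspose_mul, conjTranspose_conjTranspose,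
      show V * Y * Uᴴ * (U * (Yᴴ * Vᴴ)) * (V * diagonal (fun i => (q i : ℂ)) * Vᴴ)
        = V * (Y * (Uᴴ * U) * Yᴴ * (Vᴴ * V) * diagonal (fun i => (q i : ℂ))) * Vᴴ by
          simp only [mul_assoc],
      trace_mul_comm, ← mul_assoc, hρ.conj_mul, hσ.conj_mul]
    simp only [one_mul, mul_one]
  have h3 : trace ((V * Y * Uᴴ)ᴴ * (V * Y * Uᴴ) * ρ)
      = trace (Yᴴ * Y * diagonal (fun i => (p i : ℂ))) := by
    rw [hρ.eq, conjTranspose_mul, conjTranspose_mul, conjTranspose_conjTranspose,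
      show U * (Yᴴ * Vᴴ) * (V * Y * Uᴴ) * (U * diagonal (fun i => (p i : ℂ)) * Uᴴ)
        = U * (Yᴴ * (Vᴴ * V) * Y * (Uᴴ * U) * diagonal (fun i => (p i : ℂ))) * Uᴴ by
          simp only [mul_assoc],
      trace_mul_comm, ← mul_assoc, hρ.conj_mul, hσ.conj_mul]
    simp only [one_mul, mul_one]
  have e1 : (trace (Yᴴ * ((Vᴴ * U) * diagonal (fun i => (p i : ℂ))))).re
      = ∑ j, ∑ i, (star (Y j i) * (Vᴴ * U) j i).re * p i := by
    rw [Finset.sum_comm, trace, Complex.re_sum]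
    refine Finset.sum_congr rfl fun i _ => ?_
    rw [diag_apply, mul_apply, Complex.re_sum]
    refine Finset.sum_congr rfl fun j _ => ?_
    rw [mul_diagonal, conjTranspose_apply, ← mul_assoc, Complex.re_mul_ofReal]
  have e2 : (trace (Y * Yᴴ * diagonal (fun i => (q i : ℂ)))).re
      = ∑ j, ∑ i, q j * Complex.normSq (Y j i) := by
    rw [trace, Complex.re_sum]
    refine Finset.sum_congr rfl fun j _ => ?_
    rw [diag_apply, mul_diagonal, Complex.re_mul_ofReal, mul_apply, Complex.re_sum,
      mul_comm, Finset.mul_sum]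
    refine Finset.sum_congr rfl fun i _ => ?_
    rw [conjTranspose_apply, Complex.star_def, Complex.mul_conj, Complex.ofReal_re]
  have e3 : (trace (Yᴴ * Y * diagonal (fun i => (p i : ℂ)))).re
      = ∑ j, ∑ i, p i * Complex.normSq (Y j i) := by
    rw [Finset.sum_comm, trace, Complex.re_sum]
    refine Finset.sum_congr rfl fun j _ => ?_
    rw [diag_apply, mul_diagonal, Complex.re_mul_ofReal, mul_apply, Complex.re_sum,
      mul_comm, Finset.mul_sum]
    refine Finset.sum_congr rfl fun i _ => ?_
    rw [conjTranspose_apply, Complex.star_def, mul_comm (starRingEnd ℂ _), Complex.mul_conj,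
      Complex.ofReal_re]
  rw [resolventForm, h1, h2, h3, e1, e2, e3]
  simp only [Finset.mul_sum, ← Finset.sum_sub_distrib]
  refine Finset.sum_congr rfl fun j _ => Finset.sum_congr rfl fun i _ => ?_
  ring

/-- Complete the square: the defect is a multiple of `|(q + t p) y - p w|²`. The case `p = 0` is
separate, since then `q + t p` may vanish. -/
theorem resolvent_term_le {t p q : ℝ} (ht : 0 < t) (hp : 0 ≤ p) (hq : 0 ≤ q) (y w : ℂ) :
    2 * (star y * w).re * p - (q + t * p) * Complex.normSq y
      ≤ Complex.normSq w * p * (p / (q + t * p)) := by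
  have hs : 0 ≤ q + t * p := by positivity
  rcases hp.eq_or_lt with rfl | hp
  · simpa using mul_nonneg hq (Complex.normSq_nonneg y)
  have hs : 0 < q + t * p := by positivity
  rw [← mul_div_assoc, le_div_iff₀ hs]
  simp only [Complex.normSq_apply, Complex.mul_re, Complex.star_def, Complex.conj_re,
    Complex.conj_im]
  nlinarith [sq_nonneg ((q + t * p) * y.re - w.re * p), sq_nonneg ((q + t * p) * y.im - w.im * p)]

theorem resolvent_term_eq {t p q : ℝ} (ht : 0 < t) (hp : 0 ≤ p) (hq : 0 ≤ q) (w : ℂ) :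
    2 * (star (w * (p / (q + t * p) : ℝ)) * w).re * p
        - (q + t * p) * Complex.normSq (w * (p / (q + t * p) : ℝ))
      = Complex.normSq w * p * (p / (q + t * p)) := by
  rcases hp.eq_or_lt with rfl | hp
  · simp
  have hs : 0 < q + t * p := by positivity
  simp only [Complex.normSq_apply, Complex.mul_re, Complex.star_def, Complex.conj_re,
    Complex.conj_im, Complex.mul_im, Complex.ofReal_re, Complex.ofReal_im]
  field_simp
  ring

theorem resolventForm_le (hρ : UnitaryDiag U p ρ) (hσ : UnitaryDiag V q σ) (hp : ∀ i, 0 ≤ p i)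
    (hq : ∀ j, 0 ≤ q j) {t : ℝ} (ht : 0 < t) (X : Matrix n n ℂ) :
    resolventForm t ρ σ X ≤ ∑ j, ∑ i,
      Complex.normSq ((Vᴴ * U) j i) * p i * (p i / (q j + t * p i)) := by
  have hX : X = V * (Vᴴ * X * U) * Uᴴ := by
    rw [show V * (Vᴴ * X * U) * Uᴴ = (V * Vᴴ) * X * (U * Uᴴ) by simp only [mul_assoc],
      hρ.mul_conj, hσ.mul_conj, one_mul, mul_one]
  rw [hX, resolventForm_conj hρ hσ]
  exact Finset.sum_le_sum fun j _ => Finset.sum_le_sum fun i _ =>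
    resolvent_term_le ht (hp i) (hq j) _ _

theorem exists_resolventForm_eq (hρ : UnitaryDiag U p ρ) (hσ : UnitaryDiag V q σ)
    (hp : ∀ i, 0 ≤ p i) (hq : ∀ j, 0 ≤ q j) {t : ℝ} (ht : 0 < t) :
    ∃ X, resolventForm t ρ σ X = ∑ j, ∑ i,
      Complex.normSq ((Vᴴ * U) j i) * p i * (p i / (q j + t * p i)) := by
  -- Each entry is the scalar maximizer `y = p w / (q + t p)`, where the completed square vanishes.
  refine ⟨V * (of fun j i => (Vᴴ * U) j i * ((p i / (q j + t * p i) : ℝ) : ℂ)) * Uᴴ, ?_⟩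
  rw [resolventForm_conj hρ hσ]
  exact Finset.sum_congr rfl fun j _ => Finset.sum_congr rfl fun i _ =>
    resolvent_term_eq ht (hp i) (hq j) _

theorem sum_normSq_mul (hρ : UnitaryDiag U p ρ) (V : Matrix n n ℂ) (j : n) :
    ∑ i, Complex.normSq ((Vᴴ * U) j i) * p i = ((Vᴴ * ρ * V) j j).re := by
  have : Vᴴ * ρ * V = (Vᴴ * U) * diagonal (fun i => (p i : ℂ)) * (Vᴴ * U)ᴴ := by
    rw [hρ.eq, conjTranspose_mul, conjTranspose_conjTranspose]; simp only [mul_assoc]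
  rw [this, mul_apply, Complex.re_sum]
  refine Finset.sum_congr rfl fun i _ => ?_
  rw [mul_diagonal, conjTranspose_apply, Complex.star_def, mul_right_comm, Complex.mul_conj,
    ← Complex.ofReal_mul, Complex.ofReal_re]

theorem sum_normSq_col (hρ : UnitaryDiag U p ρ) (hσ : UnitaryDiag V q σ) (i : n) :
    ∑ j, Complex.normSq ((Vᴴ * U) j i) = 1 := by
  have h : (Vᴴ * U)ᴴ * (Vᴴ * U) = 1 := by
    rw [conjTranspose_mul, conjTranspose_conjTranspose,
      show Uᴴ * V * (Vᴴ * U) = Uᴴ * (V * Vᴴ) * U by simp only [mul_assoc], hσ.mul_conj, mul_one,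
      hρ.conj_mul]
  have h' := congrArg Complex.re (congrFun (congrFun h i) i)
  rw [mul_apply, Complex.re_sum, one_apply_eq, Complex.one_re] at h'
  rw [← h']
  refine Finset.sum_congr rfl fun j _ => ?_
  rw [conjTranspose_apply, Complex.star_def, mul_comm, Complex.mul_conj, Complex.ofReal_re]

/-- The assumption `hsupp` says that `ρ` has no weight on the kernel of `σ`. A vanishing sum of
nonnegative overlaps vanishes termwise, so every logarithm carrying weight has a positive argument.
-/
theorem pos_of_overlap_ne_zero (hρ : UnitaryDiag U p ρ) (hp : ∀ i, 0 ≤ p i)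
    (hq : ∀ j, 0 ≤ q j) (hsupp : ∀ j, q j = 0 → ((Vᴴ * ρ * V) j j).re = 0) (x : n × n)
    (hx : Complex.normSq ((Vᴴ * U) x.1 x.2) * p x.2 ≠ 0) : 0 < p x.2 ∧ 0 < q x.1 := by
  refine ⟨(hp _).lt_of_ne' (right_ne_zero_of_mul hx), (hq _).lt_of_ne' fun h0 => hx ?_⟩
  have h1 := hsupp _ h0
  rw [← sum_normSq_mul hρ, Finset.sum_eq_zero_iff_of_nonneg
    fun i _ => mul_nonneg (Complex.normSq_nonneg _) (hp i)] at h1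
  exact h1 _ (Finset.mem_univ _)

theorem sum_overlap (hρ : UnitaryDiag U p ρ) (hσ : UnitaryDiag V q σ) :
    ∑ x : n × n, Complex.normSq ((Vᴴ * U) x.1 x.2) * p x.2 = ∑ i, p i := by
  rw [Fintype.sum_prod_type, Finset.sum_comm]
  simp only [← Finset.sum_mul, sum_normSq_col hρ hσ, one_mul]

end Resolvent

/-! ### Relative entropy and its monotonicity -/

/-- `-Tr ρ log₂ σ` for `σ = V diag(q) V†`. -/
noncomputable def crossEntropy {n : Type*} [Fintype n] (V : Matrix n n ℂ) (q : n → ℝ)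
    (ρ : Matrix n n ℂ) : ℝ :=
  -∑ j, ((Vᴴ * ρ * V) j j).re * Real.logb 2 (q j)

/-- Summing the overlaps over the eigenvectors of `σ` leaves the entropy part, and over those of `ρ`
the cross term; `Real.log 2` converts natural logarithms to base 2. -/
theorem sum_relativeEntropy_eq {n : Type*} [Fintype n] [DecidableEq n] {U V ρ σ : Matrix n n ℂ}
    {p q : n → ℝ} (hρ : UnitaryDiag U p ρ) (hσ : UnitaryDiag V q σ) :
    ∑ x : n × n, Complex.normSq ((Vᴴ * U) x.1 x.2) * p x.2 * (Real.log (p x.2) - Real.log (q x.1))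
      = Real.log 2 * (crossEntropy V q ρ - vonNeumannEntropy ρ) := by
  have hl : Real.log 2 ≠ 0 := (Real.log_pos one_lt_two).ne'
  have e1 : ∑ j, ∑ i, Complex.normSq ((Vᴴ * U) j i) * p i * Real.log (p i)
      = Real.log 2 * ∑ i, p i * Real.logb 2 (p i) := by
    rw [Finset.sum_comm, Finset.mul_sum]
    refine Finset.sum_congr rfl fun i _ => ?_
    simp only [mul_assoc]
    rw [← Finset.sum_mul, sum_normSq_col hρ hσ, one_mul, Real.logb]
    field_simp
  have e2 : ∑ j, ∑ i, Complex.normSq ((Vᴴ * U) j i) * p i * Real.log (q j)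
      = Real.log 2 * ∑ j, ((Vᴴ * ρ * V) j j).re * Real.logb 2 (q j) := by
    rw [Finset.mul_sum]
    refine Finset.sum_congr rfl fun j _ => ?_
    rw [← Finset.sum_mul, sum_normSq_mul hρ, Real.logb]
    field_simp
  rw [hρ.entropy_eq, crossEntropy, Fintype.sum_prod_type]
  simp only [mul_sub, Finset.sum_sub_distrib]
  rw [e1, e2]
  ring

theorem trace_traceRight {m b : Type*} [Fintype m] [Fintype b] (M : Matrix (m × b) (m × b) ℂ) : (traceRight M).trace = M.trace := by
  simp [trace, traceRight, Fintype.sum_prod_type]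

/-- The partial trace is dual to `Z ↦ Z ⊗ 1`. -/
theorem trace_kronecker_one_mul {m b : Type*} [Fintype m] [Fintype b] [DecidableEq b]
    (Z : Matrix m m ℂ) (N : Matrix (m × b) (m × b) ℂ) :
    trace ((Z ⊗ₖ (1 : Matrix b b ℂ)) * N) = trace (Z * traceRight N) := by
  simp only [trace, diag_apply, mul_apply, Fintype.sum_prod_type, kroneckerMap_apply, traceRight,
    of_apply, one_apply, mul_ite, mul_one, mul_zero, ite_mul, zero_mul, Finset.sum_ite_eq,
    Finset.mem_univ, if_true, Finset.mul_sum]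
  refine Finset.sum_congr rfl fun i _ => ?_
  exact Finset.sum_comm

/-- Since `X ↦ X ⊗ 1` respects products and adjoints, trace duality applies to each of the three
terms. -/
theorem resolventForm_kronecker_one {m b : Type*} [Fintype m] [Fintype b] [DecidableEq b]
    (t : ℝ) (ρ σ : Matrix (m × b) (m × b) ℂ) (X : Matrix m m ℂ) :
    resolventForm t ρ σ (X ⊗ₖ (1 : Matrix b b ℂ))
      = resolventForm t (traceRight ρ) (traceRight σ) X := by
  simp only [resolventForm, conjTranspose_kronecker, conjTranspose_one, ← mul_kronecker_mul,
    one_mul, trace_kronecker_one_mul]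

/-- Monotonicity of the relative entropy under a partial trace. -/
theorem relativeEntropy_traceRight_le {m b : Type*} [Fintype m] [DecidableEq m] [Fintype b]
    [DecidableEq b] {ρ σ V : Matrix (m × b) (m × b) ℂ} {q : m × b → ℝ}
    {V' : Matrix m m ℂ} {q' : m → ℝ} (hρ : ρ.PosSemidef) (hρ' : (traceRight ρ).PosSemidef)
    (hσ : UnitaryDiag V q σ) (hσ' : UnitaryDiag V' q' (traceRight σ))
    (hq : ∀ j, 0 ≤ q j) (hq' : ∀ j, 0 ≤ q' j)
    (hsupp : ∀ j, q j = 0 → ((Vᴴ * ρ * V) j j).re = 0)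
    (hsupp' : ∀ j, q' j = 0 → ((V'ᴴ * traceRight ρ * V') j j).re = 0) :
    crossEntropy V' q' (traceRight ρ) - vonNeumannEntropy (traceRight ρ)
      ≤ crossEntropy V q ρ - vonNeumannEntropy ρ := by
  obtain ⟨U, p, h⟩ := UnitaryDiag.exists_of_isHermitian hρ.isHermitian
  obtain ⟨U', p', h'⟩ := UnitaryDiag.exists_of_isHermitian hρ'.isHermitian
  have hp := h.nonneg hρ
  have hp' := h'.nonneg hρ'
  have hl : 0 < Real.log 2 := Real.log_pos one_lt_two
  rw [← mul_le_mul_iff_right₀ hl, ← sum_relativeEntropy_eq h hσ, ← sum_relativeEntropy_eq h' hσ']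
  refine sum_mul_log_sub_log_le (p := fun x : (m × b) × (m × b) => p x.2)
    (q := fun x : (m × b) × (m × b) => q x.1) (p' := fun x : m × m => p' x.2)
    (q' := fun x : m × m => q' x.1) (pos_of_overlap_ne_zero h hp hq hsupp)
    (pos_of_overlap_ne_zero h' hp' hq' hsupp') ?_ fun t ht => ?_
  · rw [sum_overlap h hσ, sum_overlap h' hσ']
    have h1 := trace_traceRight ρ
    rw [h.trace_eq, h'.trace_eq] at h1
    exact_mod_cast h1.symm
  -- The optimal `X` for the marginals gives the trial matrix `X ⊗ 1` for the full problem.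
  · obtain ⟨X, hX⟩ := exists_resolventForm_eq h' hσ' hp' hq' ht
    rw [Fintype.sum_prod_type, Fintype.sum_prod_type, ← hX, ← resolventForm_kronecker_one]
    exact resolventForm_le h hσ hp hq ht _

/-! ### Marginals of states -/

section Marginals

theorem Matrix.PosSemidef.sum_submatrix {ι n m : Type*} [Fintype ι] [Fintype n] [Fintype m]
    {M : Matrix n n ℂ} (hM : M.PosSemidef) (f : ι → m → n) :
    (of fun x y => ∑ k, M (f k x) (f k y)).PosSemidef := by
  have : (of fun x y => ∑ k, M (f k x) (f k y)) = ∑ k, M.submatrix (f k) (f k) := by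
    ext x y; simp [Matrix.sum_apply]
  rw [this]
  exact posSemidef_sum _ fun k _ => hM.submatrix (f k)

variable {a a' b b' e m n : Type*} [Fintype a] [Fintype a'] [Fintype b] [Fintype b'] [Fintype e]
  [Fintype m] [Fintype n]

theorem IsState.traceRight {M : Matrix (m × n) (m × n) ℂ} (hM : IsState M) :
    IsState (traceRight M) :=
  ⟨hM.1.sum_submatrix fun k x => (x, k), (trace_traceRight M).trans hM.2⟩

theorem IsState.traceLeft {M : Matrix (m × n) (m × n) ℂ} (hM : IsState M) :
    IsState (traceLeft M) :=
  ⟨hM.1.sum_submatrix fun k x => (k, x), by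
    rw [← hM.2]; simp [trace, _root_.traceLeft, Fintype.sum_prod_type_right]⟩

theorem IsState.submatrix {M : Matrix m m ℂ} (hM : IsState M) (f : n ≃ m) :
    IsState (M.submatrix f f) :=
  ⟨hM.1.submatrix f, by rw [← hM.2]; exact f.sum_comp (fun i => M i i)⟩

theorem IsState.kronecker {M : Matrix m m ℂ} {N : Matrix n n ℂ} (hM : IsState M)
    (hN : IsState N) : IsState (M ⊗ₖ N) :=
  ⟨hM.1.kronecker hN.1, by rw [trace_kronecker, hM.2, hN.2, one_mul]⟩

theorem IsState.marginalAE {M : Matrix ((a × b) × e) ((a × b) × e) ℂ} (hM : IsState M) :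
    IsState (marginalAE M) :=
  let g : (a × e) × b ≃ (a × b) × e :=
    ⟨fun x => ((x.1.1, x.2), x.1.2), fun x => ((x.1.1, x.2), x.1.2), fun _ => rfl, fun _ => rfl⟩
  (hM.submatrix g).traceRight

theorem IsState.marginalBE {M : Matrix ((a × b) × e) ((a × b) × e) ℂ} (hM : IsState M) :
    IsState (marginalBE M) :=
  (hM.submatrix (Equiv.prodAssoc a b e).symm).traceLeft

theorem traceLeft_marginalAE {a b e : Type*} [Fintype a] [Fintype b]
    (M : Matrix ((a × b) × e) ((a × b) × e) ℂ) :
    traceLeft (marginalAE M) = traceLeft M := by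
  ext k k'
  simp [traceLeft, marginalAE, Fintype.sum_prod_type]

end Marginals

/-! ### Strong subadditivity -/

section StrongSubadditivity

variable {a b c e : Type*} [Fintype a] [DecidableEq a] [Fintype b] [DecidableEq b] [Fintype c]
  [Fintype e] [DecidableEq e]

theorem one_kronecker_mul_apply (A : Matrix c c ℂ) (N : Matrix (a × c) (a × c) ℂ) (x y : a × c) :
    (((1 : Matrix a a ℂ) ⊗ₖ A) * N) x y = ∑ g, A x.2 g * N (x.1, g) y := by
  simp [mul_apply, Fintype.sum_prod_type, one_apply]

theorem mul_one_kronecker_apply (A : Matrix c c ℂ) (N : Matrix (a × c) (a × c) ℂ) (x y : a × c) :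
    (N * ((1 : Matrix a a ℂ) ⊗ₖ A)) x y = ∑ h, N x (y.1, h) * A h y.2 := by
  simp [mul_apply, Fintype.sum_prod_type, one_apply]

theorem sum_one_kronecker_conj (N : Matrix (a × c) (a × c) ℂ) (V : Matrix c c ℂ) (f : c) :
    ∑ i, (((1 : Matrix a a ℂ) ⊗ₖ V)ᴴ * N * ((1 : Matrix a a ℂ) ⊗ₖ V)) (i, f) (i, f)
      = (Vᴴ * traceLeft N * V) f f := by
  simp only [conjTranspose_kronecker, conjTranspose_one, mul_one_kronecker_apply,
    one_kronecker_mul_apply]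
  rw [Finset.sum_comm, mul_apply]
  refine Finset.sum_congr rfl fun h _ => ?_
  rw [← Finset.sum_mul, Finset.sum_comm, mul_apply]
  simp only [traceLeft, of_apply, Finset.mul_sum]

/-- Tensoring with the identity commutes with the logarithm, so the cross term sees only the
marginal of `N`. The factor `1 * q` is the eigenvalue as produced by `UnitaryDiag.kronecker`. -/
theorem crossEntropy_one_kronecker [DecidableEq c] {N : Matrix (a × c) (a × c) ℂ} {V : Matrix c c ℂ} {q : c → ℝ}
    (h : UnitaryDiag V q (traceLeft N)) :
    crossEntropy ((1 : Matrix a a ℂ) ⊗ₖ V) (fun x => 1 * q x.2) N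
      = vonNeumannEntropy (traceLeft N) := by
  rw [h.entropy_eq, crossEntropy, Fintype.sum_prod_type_right]
  congr 1
  refine Finset.sum_congr rfl fun f _ => ?_
  simp only [one_mul]
  rw [← Finset.sum_mul, ← Complex.re_sum, sum_one_kronecker_conj, h.diag_eq, diagonal_apply_eq,
    Complex.ofReal_re]

/-- A state has no weight off the support of its marginal: the nonnegative diagonal entries over a
zero eigenvalue sum to that eigenvalue. This supplies the support conditions for monotonicity. -/
theorem one_kronecker_conj_eq_zero [DecidableEq c] {N : Matrix (a × c) (a × c) ℂ} (hN : N.PosSemidef)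
    {V : Matrix c c ℂ} {q : c → ℝ} (h : UnitaryDiag V q (traceLeft N)) (x : a × c)
    (hx : 1 * q x.2 = 0) :
    ((((1 : Matrix a a ℂ) ⊗ₖ V)ᴴ * N * ((1 : Matrix a a ℂ) ⊗ₖ V)) x x).re = 0 := by
  have h1 := congrArg Complex.re (sum_one_kronecker_conj N V x.2)
  rw [h.diag_eq, diagonal_apply_eq, Complex.ofReal_re, ← one_mul (q x.2), hx, Complex.re_sum,
    Finset.sum_eq_zero_iff_of_nonneg] at h1
  · exact h1 x.1 (Finset.mem_univ _)
  · intro i _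
    exact (Complex.le_def.1 (hN.conjTranspose_mul_mul_same _).diag_nonneg).1

theorem conj_submatrix {n m : Type*} [Fintype n] [Fintype m] (V ρ : Matrix n n ℂ) (g : m ≃ n) :
    (V.submatrix g g)ᴴ * ρ.submatrix g g * V.submatrix g g = (Vᴴ * ρ * V).submatrix g g := by
  rw [conjTranspose_submatrix, submatrix_mul_equiv, submatrix_mul_equiv]

theorem crossEntropy_submatrix {n m : Type*} [Fintype n] [Fintype m] (V ρ : Matrix n n ℂ)
    (q : n → ℝ) (g : m ≃ n) :
    crossEntropy (V.submatrix g g) (q ∘ g) (ρ.submatrix g g) = crossEntropy V q ρ := by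
  rw [crossEntropy, conj_submatrix]
  exact congrArg _ (g.sum_comp fun j => ((Vᴴ * ρ * V) j j).re * Real.logb 2 (q j))

/-- Strong subadditivity of the von Neumann entropy. -/
theorem condMutualInfo_nonneg {M : Matrix ((a × b) × e) ((a × b) × e) ℂ} (hM : IsState M) :
    0 ≤ condMutualInfo M := by
  -- The reordering puts `B` last, so that `traceRight` removes it.
  let g : (a × e) × b ≃ a × (b × e) :=
    ⟨fun x => (x.1.1, (x.2, x.1.2)), fun x => ((x.1, x.2.2), x.2.1), fun _ => rfl, fun _ => rfl⟩
  let N : Matrix (a × (b × e)) (a × (b × e)) ℂ :=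
    M.submatrix (Equiv.prodAssoc a b e).symm (Equiv.prodAssoc a b e).symm
  have hN : IsState N := hM.submatrix (Equiv.prodAssoc a b e).symm
  have hNBE : traceLeft N = marginalBE M := rfl
  have hNAE : traceRight (N.submatrix g g) = marginalAE M := rfl
  obtain ⟨V, q, hV⟩ := UnitaryDiag.exists_of_isHermitian hN.traceLeft.1.isHermitian
  obtain ⟨V', q', hV'⟩ := UnitaryDiag.exists_of_isHermitian hM.marginalAE.traceLeft.1.isHermitian
  have hq := hV.nonneg hN.traceLeft.1
  have hq' := hV'.nonneg hM.marginalAE.traceLeft.1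
  have hσ := ((UnitaryDiag.one (n := a)).kronecker hV).submatrix g
  have hσ' := (UnitaryDiag.one (n := a)).kronecker hV'
  -- Tracing out `B` turns `1_A ⊗ ρ^{BE}` into `1_A ⊗ ρ^E`, so `key` will read `S(E) - S(AE) ≤ S(BE)
  -- - S(ABE)`.
  have htr : traceRight (((1 : Matrix a a ℂ) ⊗ₖ traceLeft N).submatrix g g)
      = (1 : Matrix a a ℂ) ⊗ₖ traceLeft (marginalAE M) := by
    ext x y
    have h1 : ∑ k, traceLeft N (k, x.2) (k, y.2) = traceLeft (marginalAE M) x.2 y.2 :=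
      Finset.sum_comm
    rw [kroneckerMap_apply, ← h1, Finset.mul_sum]
    rfl
  have key := relativeEntropy_traceRight_le (ρ := N.submatrix g g) (hN.submatrix g).1
    hM.marginalAE.1 hσ (htr ▸ hσ') (fun j => by simpa using hq _) (fun j => by simpa using hq' _)
    (fun j hj => by
      rw [conj_submatrix]; exact one_kronecker_conj_eq_zero hN.1 hV (g j) hj)
    (fun j hj => one_kronecker_conj_eq_zero hM.marginalAE.1 hV' j hj)
  rw [crossEntropy_submatrix, crossEntropy_one_kronecker hV, hNAE,
    crossEntropy_one_kronecker hV', vonNeumannEntropy_submatrix hN.1.isHermitian, hNBE,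
    vonNeumannEntropy_submatrix hM.1.isHermitian, traceLeft_marginalAE] at key
  rw [condMutualInfo]
  linarith

end StrongSubadditivity

/-! ### Extensions, relabelling and the infimum -/

theorem IsExtension.submatrix {a a' b b' e e' : Type*} [Fintype a] [Fintype a'] [Fintype b]
    [Fintype b'] [Fintype e] [Fintype e'] {ρ : Matrix (a × b) (a × b) ℂ}
    {σ : Matrix ((a × b) × e) ((a × b) × e) ℂ} (hσ : IsExtension ρ σ)
    (f : a' ≃ a) (g : b' ≃ b) (h : e' ≃ e) :
    IsExtension (ρ.submatrix (f.prodCongr g) (f.prodCongr g))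
      (σ.submatrix ((f.prodCongr g).prodCongr h) ((f.prodCongr g).prodCongr h)) := by
  refine ⟨hσ.1.submatrix _, ?_⟩
  rw [← hσ.2]
  ext x y
  exact h.sum_comp fun k => σ ((f.prodCongr g) x, k) ((f.prodCongr g) y, k)

section Squashed

variable {a a' b b' e e' : Type*}
  [Fintype a] [DecidableEq a] [Fintype a'] [DecidableEq a'] [Fintype b] [DecidableEq b]
  [Fintype b'] [DecidableEq b'] [Fintype e] [DecidableEq e] [Fintype e'] [DecidableEq e']

theorem condMutualInfo_submatrix {M : Matrix ((a × b) × e) ((a × b) × e) ℂ} (hM : IsState M)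
    (f : a' ≃ a) (g : b' ≃ b) (h : e' ≃ e) :
    condMutualInfo (M.submatrix ((f.prodCongr g).prodCongr h) ((f.prodCongr g).prodCongr h))
      = condMutualInfo M := by
  have h1 : marginalAE (M.submatrix ((f.prodCongr g).prodCongr h) ((f.prodCongr g).prodCongr h))
      = (marginalAE M).submatrix (f.prodCongr h) (f.prodCongr h) := by
    ext x y
    exact g.sum_comp fun j => M ((f x.1, j), h x.2) ((f y.1, j), h y.2)
  have h2 : marginalBE (M.submatrix ((f.prodCongr g).prodCongr h) ((f.prodCongr g).prodCongr h))
      = (marginalBE M).submatrix (g.prodCongr h) (g.prodCongr h) := by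
    ext x y
    exact f.sum_comp fun j => M ((j, g x.1), h x.2) ((j, g y.1), h y.2)
  have h3 : traceLeft (M.submatrix ((f.prodCongr g).prodCongr h) ((f.prodCongr g).prodCongr h))
      = (traceLeft M).submatrix h h := by
    ext x y
    exact (f.prodCongr g).sum_comp fun j => M (j, h x) (j, h y)
  rw [condMutualInfo, h1, h2, h3, vonNeumannEntropy_submatrix hM.marginalAE.1.isHermitian,
    vonNeumannEntropy_submatrix hM.marginalBE.1.isHermitian,
    vonNeumannEntropy_submatrix hM.1.isHermitian,
    vonNeumannEntropy_submatrix hM.traceLeft.1.isHermitian, condMutualInfo]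

/-- This allows extending systems indexed by any finite type, such as products, although the infimum
ranges only over `Fin d`. -/
theorem IsExtension.mem_squashedValues {ρ : Matrix (a × b) (a × b) ℂ}
    {σ : Matrix ((a × b) × e) ((a × b) × e) ℂ} (hσ : IsExtension ρ σ) :
    (1 / 2 : ℝ) * condMutualInfo σ ∈ squashedValues ρ :=
  ⟨Fintype.card e, _, hσ.submatrix (Equiv.refl a) (Equiv.refl b) (Fintype.equivFin e).symm, by
    rw [condMutualInfo_submatrix hσ.1]⟩

theorem squashedValues_subset_submatrix (ρ : Matrix (a × b) (a × b) ℂ) (f : a' ≃ a) (g : b' ≃ b) :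
    squashedValues ρ ⊆ squashedValues (ρ.submatrix (f.prodCongr g) (f.prodCongr g)) := by
  rintro x ⟨d, σ, hσ, rfl⟩
  exact ⟨d, _, hσ.submatrix f g (Equiv.refl _), by rw [condMutualInfo_submatrix hσ.1]⟩

theorem squashedEntanglement_submatrix (ρ : Matrix (a × b) (a × b) ℂ) (f : a' ≃ a) (g : b' ≃ b) :
    squashedEntanglement (ρ.submatrix (f.prodCongr g) (f.prodCongr g))
      = squashedEntanglement ρ := by
  refine congrArg sInf (Set.Subset.antisymm ?_ (squashedValues_subset_submatrix ρ f g))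
  have h := squashedValues_subset_submatrix (ρ.submatrix (f.prodCongr g) (f.prodCongr g))
    f.symm g.symm
  have h' : (ρ.submatrix (f.prodCongr g) (f.prodCongr g)).submatrix (f.symm.prodCongr g.symm)
      (f.symm.prodCongr g.symm) = ρ := by
    ext ⟨_, _⟩ ⟨_, _⟩; simp
  rwa [h'] at h

theorem squashedValues_nonempty {ρ : Matrix (a × b) (a × b) ℂ} (hρ : IsState ρ) :
    (squashedValues ρ).Nonempty := by
  -- The trivial extension, with one-dimensional `E`.
  have h : IsExtension ρ (ρ.submatrix (Equiv.prodUnique (a × b) Unit)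
      (Equiv.prodUnique (a × b) Unit)) := by
    refine ⟨hρ.submatrix _, ?_⟩
    ext x y
    simp [traceRight]
  exact ⟨_, h.mem_squashedValues⟩

theorem squashedValues_nonneg {ρ : Matrix (a × b) (a × b) ℂ} {x : ℝ}
    (hx : x ∈ squashedValues ρ) : 0 ≤ x := by
  obtain ⟨d, σ, hσ, rfl⟩ := hx
  exact mul_nonneg (by norm_num) (condMutualInfo_nonneg hσ.1)

theorem squashedValues_bddBelow (ρ : Matrix (a × b) (a × b) ℂ) : BddBelow (squashedValues ρ) :=
  ⟨0, fun _ hx => squashedValues_nonneg hx⟩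

theorem IsExtension.squashedEntanglement_le {ρ : Matrix (a × b) (a × b) ℂ}
    {σ : Matrix ((a × b) × e) ((a × b) × e) ℂ} (hσ : IsExtension ρ σ) :
    squashedEntanglement ρ ≤ (1 / 2 : ℝ) * condMutualInfo σ :=
  csInf_le (squashedValues_bddBelow ρ) hσ.mem_squashedValues

/-! ### Strong superadditivity -/

/-- The chain rule for the conditional mutual information with strong subadditivity:
`I(A;B|E) + I(A';B'|ABE) ≤ I(AA';BB'|E)`. -/
theorem squashedEntanglement_marginals_le {ρ : Matrix ((a × a') × (b × b')) ((a × a') × (b × b')) ℂ}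
    {σ : Matrix (((a × a') × (b × b')) × e) (((a × a') × (b × b')) × e) ℂ}
    (hσ : IsExtension ρ σ) :
    squashedEntanglement (marginalAB ρ) + squashedEntanglement (marginalPrimed ρ)
      ≤ (1 / 2 : ℝ) * condMutualInfo σ := by
  let g₂ : (a' × b') × ((a × b) × e) ≃ ((a × a') × (b × b')) × e :=
    ⟨fun x => (((x.2.1.1, x.1.1), (x.2.1.2, x.1.2)), x.2.2),
      fun x => ((x.1.1.2, x.1.2.2), ((x.1.1.1, x.1.2.1), x.2)), fun _ => rfl, fun _ => rfl⟩
  let g₃ : ((a' × b) × (a × e)) × b' ≃ ((a × a') × (b × b')) × e :=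
    ⟨fun x => (((x.1.2.1, x.1.1.1), (x.1.1.2, x.2)), x.1.2.2),
      fun x => (((x.1.1.2, x.1.2.1), (x.1.1.1, x.2)), x.1.2.2), fun _ => rfl, fun _ => rfl⟩
  let g₄ : ((a × b') × (b × e)) × a' ≃ ((a × a') × (b × b')) × e :=
    ⟨fun x => (((x.1.1.1, x.2), (x.1.2.1, x.1.1.2)), x.1.2.2),
      fun x => (((x.1.1.1, x.1.2.2), (x.1.2.1, x.2)), x.1.1.2), fun _ => rfl, fun _ => rfl⟩
  -- `τ₂` is all of `σ`, read as an extension of the `A'B'` marginal by `ABE`; `τ₁` is its reduction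
  -- to `ABE`, extending the `AB` marginal by `E`.
  set τ₂ := σ.submatrix g₂ g₂ with hτ₂
  have sτ₂ : IsState τ₂ := hσ.1.submatrix g₂
  set τ₁ := traceLeft τ₂ with hτ₁
  have sτ₁ : IsState τ₁ := sτ₂.traceLeft
  set ω₁ := traceRight (σ.submatrix g₃ g₃) with hω₁
  have sω₁ : IsState ω₁ := (hσ.1.submatrix g₃).traceRight
  set ω₂ := traceRight (σ.submatrix g₄ g₄) with hω₂
  have sω₂ : IsState ω₂ := (hσ.1.submatrix g₄).traceRight
  have x₁ : IsExtension (marginalAB ρ) τ₁ := by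
    refine ⟨sτ₁, ?_⟩
    rw [← hσ.2]
    ext x y
    exact Finset.sum_comm.trans (Fintype.sum_prod_type _)
  have x₂ : IsExtension (marginalPrimed ρ) τ₂ := by
    refine ⟨sτ₂, ?_⟩
    rw [← hσ.2]
    ext x y
    exact (Fintype.sum_prod_type _).trans (Fintype.sum_prod_type _)
  -- These are the discarded chain-rule terms `I(A';B|AE)` and `I(A;B'|BE)`. The identities below
  -- match all the entropies so that the chain rule becomes linear arithmetic.
  have i₁ := condMutualInfo_nonneg sω₁
  have i₂ := condMutualInfo_nonneg sω₂
  have l₁ := x₁.squashedEntanglement_le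
  have l₂ := x₂.squashedEntanglement_le
  have eσ : vonNeumannEntropy τ₂ = vonNeumannEntropy σ :=
    vonNeumannEntropy_submatrix hσ.1.1.isHermitian g₂
  have eE : traceLeft τ₁ = traceLeft σ := by
    ext x y
    exact (Fintype.sum_prod_type fun i : (a × b) × (a' × b') =>
      σ (Equiv.prodProdProdComm a b a' b' i, x) (Equiv.prodProdProdComm a b a' b' i, y)).symm.trans
      ((Equiv.prodProdProdComm a b a' b').sum_comp
      fun i => σ (i, x) (i, y))
  have eω₁A : vonNeumannEntropy (marginalAE ω₁) = vonNeumannEntropy (marginalAE σ) := by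
    let h : a' × (a × e) ≃ (a × a') × e :=
      ⟨fun x => ((x.2.1, x.1), x.2.2), fun x => (x.1.2, (x.1.1, x.2)), fun _ => rfl, fun _ => rfl⟩
    rw [← vonNeumannEntropy_submatrix hσ.1.marginalAE.1.isHermitian h]
    congr 1
    ext x y
    exact (Fintype.sum_prod_type fun p : b × b' =>
      σ (((x.2.1, x.1), p), x.2.2) (((y.2.1, y.1), p), y.2.2)).symm
  have eω₁B : vonNeumannEntropy (marginalBE ω₁) = vonNeumannEntropy τ₁ := by
    let h : b × (a × e) ≃ (a × b) × e :=
      ⟨fun x => ((x.2.1, x.1), x.2.2), fun x => (x.1.2, (x.1.1, x.2)), fun _ => rfl, fun _ => rfl⟩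
    rw [← vonNeumannEntropy_submatrix sτ₁.1.isHermitian h]
    congr 1
    ext x y
    exact (Fintype.sum_prod_type fun p : a' × b' =>
      σ (((x.2.1, p.1), (x.1, p.2)), x.2.2) (((y.2.1, p.1), (y.1, p.2)), y.2.2)).symm
  have eω₁ : vonNeumannEntropy ω₁ = vonNeumannEntropy (marginalAE τ₂) := by
    let h : (a' × b) × (a × e) ≃ a' × ((a × b) × e) :=
      ⟨fun x => (x.1.1, ((x.2.1, x.1.2), x.2.2)), fun x => ((x.1, x.2.1.2), (x.2.1.1, x.2.2)),
        fun _ => rfl, fun _ => rfl⟩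
    exact vonNeumannEntropy_submatrix sτ₂.marginalAE.1.isHermitian h
  have eω₁E : traceLeft ω₁ = marginalAE τ₁ := by
    ext x y
    refine (Fintype.sum_prod_type _).trans (Finset.sum_comm.trans ?_)
    exact Finset.sum_congr rfl fun j _ => (Fintype.sum_prod_type fun p : a' × b' =>
      σ (((x.1, p.1), (j, p.2)), x.2) (((y.1, p.1), (j, p.2)), y.2)).symm
  have eω₂A : vonNeumannEntropy (marginalAE ω₂) = vonNeumannEntropy τ₁ := by
    rw [← vonNeumannEntropy_submatrix sτ₁.1.isHermitian (Equiv.prodAssoc a b e).symm]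
    congr 1
    ext x y
    exact (Fintype.sum_prod_type_right fun p : a' × b' =>
      σ (((x.1, p.1), (x.2.1, p.2)), x.2.2) (((y.1, p.1), (y.2.1, p.2)), y.2.2)).symm
  have eω₂B : vonNeumannEntropy (marginalBE ω₂) = vonNeumannEntropy (marginalBE σ) := by
    let h : b' × (b × e) ≃ (b × b') × e :=
      ⟨fun x => ((x.2.1, x.1), x.2.2), fun x => (x.1.2, (x.1.1, x.2)), fun _ => rfl, fun _ => rfl⟩
    rw [← vonNeumannEntropy_submatrix hσ.1.marginalBE.1.isHermitian h]
    congr 1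
    ext x y
    exact (Fintype.sum_prod_type fun p : a × a' =>
      σ ((p, (x.2.1, x.1)), x.2.2) ((p, (y.2.1, y.1)), y.2.2)).symm
  have eω₂ : vonNeumannEntropy ω₂ = vonNeumannEntropy (marginalBE τ₂) := by
    let h : (a × b') × (b × e) ≃ b' × ((a × b) × e) :=
      ⟨fun x => (x.1.2, ((x.1.1, x.2.1), x.2.2)), fun x => ((x.2.1.1, x.1), (x.2.1.2, x.2.2)),
        fun _ => rfl, fun _ => rfl⟩
    exact vonNeumannEntropy_submatrix sτ₂.marginalBE.1.isHermitian h
  have eω₂E : traceLeft ω₂ = marginalBE τ₁ := by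
    ext x y
    refine (Fintype.sum_prod_type _).trans ?_
    exact Finset.sum_congr rfl fun i _ => (Fintype.sum_prod_type_right fun p : a' × b' =>
      σ (((i, p.1), (x.1, p.2)), x.2) (((i, p.1), (y.1, p.2)), y.2)).symm
  rw [condMutualInfo, eω₁A, eω₁B, eω₁, eω₁E] at i₁
  rw [condMutualInfo, eω₂A, eω₂B, eω₂, eω₂E] at i₂
  rw [condMutualInfo, eE] at l₁
  rw [condMutualInfo, eσ, ← hτ₁] at l₂
  rw [condMutualInfo]
  linarith

theorem squashedEntanglement_superadditive {ρ : Matrix ((a × a') × (b × b')) ((a × a') × (b × b')) ℂ}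
    (hρ : IsState ρ) :
    squashedEntanglement (marginalAB ρ) + squashedEntanglement (marginalPrimed ρ)
      ≤ squashedEntanglement ρ := by
  refine le_csInf (squashedValues_nonempty hρ) ?_
  rintro x ⟨d, σ, hσ, rfl⟩
  exact squashedEntanglement_marginals_le hσ

/-! ### Additivity on tensor products -/

theorem sum_prod_mul {ι κ : Type*} [Fintype ι] [Fintype κ] (f : ι → ℂ) (g : κ → ℂ) :
    ∑ x : ι × κ, f x.1 * g x.2 = (∑ i, f i) * ∑ j, g j := by
  rw [Fintype.sum_mul_sum, Fintype.sum_prod_type]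

/-- The product of two extensions extends the product state by `EE'`. All its relevant marginals are
products, so additivity of entropy splits the conditional mutual information. -/
theorem squashedEntanglement_bipartiteTensor_le_condMutualInfo
    {ρ : Matrix (a × b) (a × b) ℂ} {ρ' : Matrix (a' × b') (a' × b') ℂ}
    {σ : Matrix ((a × b) × e) ((a × b) × e) ℂ} {σ' : Matrix ((a' × b') × e') ((a' × b') × e') ℂ}
    (hσ : IsExtension ρ σ) (hσ' : IsExtension ρ' σ') :
    squashedEntanglement (bipartiteTensor ρ ρ')
      ≤ (1 / 2 : ℝ) * condMutualInfo σ + (1 / 2 : ℝ) * condMutualInfo σ' := by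
  let g : ((a × a') × (b × b')) × (e × e') ≃ ((a × b) × e) × ((a' × b') × e') :=
    ((Equiv.prodProdProdComm a a' b b').prodCongr (Equiv.refl _)).trans
      (Equiv.prodProdProdComm (a × b) (a' × b') e e')
  have hτ : IsExtension (bipartiteTensor ρ ρ') ((σ ⊗ₖ σ').submatrix g g) := by
    refine ⟨(hσ.1.kronecker hσ'.1).submatrix g, ?_⟩
    rw [← hσ.2, ← hσ'.2]
    ext x y
    exact sum_prod_mul (fun k => σ ((x.1.1, x.2.1), k) ((y.1.1, y.2.1), k))
      fun k => σ' ((x.1.2, x.2.2), k) ((y.1.2, y.2.2), k)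
  have hA : marginalAE ((σ ⊗ₖ σ').submatrix g g) = (marginalAE σ ⊗ₖ marginalAE σ').submatrix
      (Equiv.prodProdProdComm a a' e e') (Equiv.prodProdProdComm a a' e e') := by
    ext x y
    exact sum_prod_mul (fun k => σ ((x.1.1, k), x.2.1) ((y.1.1, k), y.2.1))
      fun k => σ' ((x.1.2, k), x.2.2) ((y.1.2, k), y.2.2)
  have hB : marginalBE ((σ ⊗ₖ σ').submatrix g g) = (marginalBE σ ⊗ₖ marginalBE σ').submatrix
      (Equiv.prodProdProdComm b b' e e') (Equiv.prodProdProdComm b b' e e') := by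
    ext x y
    exact sum_prod_mul (fun k => σ ((k, x.1.1), x.2.1) ((k, y.1.1), y.2.1))
      fun k => σ' ((k, x.1.2), x.2.2) ((k, y.1.2), y.2.2)
  have hE : traceLeft ((σ ⊗ₖ σ').submatrix g g) = traceLeft σ ⊗ₖ traceLeft σ' := by
    ext x y
    exact ((Equiv.prodProdProdComm a a' b b').sum_comp
      fun i => σ (i.1, x.1) (i.1, y.1) * σ' (i.2, x.2) (i.2, y.2)).trans
      (sum_prod_mul (fun k => σ (k, x.1) (k, y.1)) fun k => σ' (k, x.2) (k, y.2))
  refine hτ.squashedEntanglement_le.trans_eq ?_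
  rw [condMutualInfo, hA, hB, hE,
    vonNeumannEntropy_submatrix (hσ.1.marginalAE.kronecker hσ'.1.marginalAE).1.isHermitian,
    vonNeumannEntropy_submatrix (hσ.1.marginalBE.kronecker hσ'.1.marginalBE).1.isHermitian,
    vonNeumannEntropy_submatrix (hσ.1.kronecker hσ'.1).1.isHermitian,
    vonNeumannEntropy_kronecker hσ.1.marginalAE hσ'.1.marginalAE,
    vonNeumannEntropy_kronecker hσ.1.marginalBE hσ'.1.marginalBE,
    vonNeumannEntropy_kronecker hσ.1 hσ'.1,
    vonNeumannEntropy_kronecker hσ.1.traceLeft hσ'.1.traceLeft, condMutualInfo, condMutualInfo]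
  ring

theorem squashedEntanglement_bipartiteTensor_le {ρ : Matrix (a × b) (a × b) ℂ}
    {ρ' : Matrix (a' × b') (a' × b') ℂ} (hρ : IsState ρ) (hρ' : IsState ρ') :
    squashedEntanglement (bipartiteTensor ρ ρ')
      ≤ squashedEntanglement ρ + squashedEntanglement ρ' := by
  -- The two infima are taken one at a time, each with the other term moved across the inequality.
  rw [← sub_le_iff_le_add]
  refine le_csInf (squashedValues_nonempty hρ) ?_
  rintro x ⟨d, σ, hσ, rfl⟩
  rw [sub_le_comm]
  refine le_csInf (squashedValues_nonempty hρ') ?_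
  rintro x ⟨d', σ', hσ', rfl⟩
  rw [sub_le_iff_le_add']
  exact squashedEntanglement_bipartiteTensor_le_condMutualInfo hσ hσ'

theorem IsState.bipartiteTensor {a a' b b' : Type*} [Fintype a] [Fintype a'] [Fintype b]
    [Fintype b'] {ρ : Matrix (a × b) (a × b) ℂ}
    {ρ' : Matrix (a' × b') (a' × b') ℂ} (hρ : IsState ρ) (hρ' : IsState ρ') :
    IsState (bipartiteTensor ρ ρ') :=
  (hρ.kronecker hρ').submatrix _

theorem marginalAB_bipartiteTensor {a a' b b' : Type*} [Fintype a'] [Fintype b']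
    (ρ : Matrix (a × b) (a × b) ℂ) {ρ' : Matrix (a' × b') (a' × b') ℂ}
    (hρ' : ρ'.trace = 1) : marginalAB (bipartiteTensor ρ ρ') = ρ := by
  ext x y
  have h : ∑ i, ∑ j, ρ' (i, j) (i, j) = 1 := (Fintype.sum_prod_type _).symm.trans hρ'
  simp [marginalAB, bipartiteTensor, ← Finset.mul_sum, h]

theorem marginalPrimed_bipartiteTensor {a a' b b' : Type*} [Fintype a] [Fintype b]
    {ρ : Matrix (a × b) (a × b) ℂ} (ρ' : Matrix (a' × b') (a' × b') ℂ)
    (hρ : ρ.trace = 1) : marginalPrimed (bipartiteTensor ρ ρ') = ρ' := by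
  ext x y
  have h : ∑ i, ∑ j, ρ (i, j) (i, j) = 1 := (Fintype.sum_prod_type _).symm.trans hρ
  simp [marginalPrimed, bipartiteTensor, ← Finset.sum_mul, h]

theorem squashedEntanglement_bipartiteTensor {ρ : Matrix (a × b) (a × b) ℂ}
    {ρ' : Matrix (a' × b') (a' × b') ℂ} (hρ : IsState ρ) (hρ' : IsState ρ') :
    squashedEntanglement (bipartiteTensor ρ ρ')
      = squashedEntanglement ρ + squashedEntanglement ρ' := by
  refine le_antisymm (squashedEntanglement_bipartiteTensor_le hρ hρ') ?_
  have h := squashedEntanglement_superadditive (hρ.bipartiteTensor hρ')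
  rwa [marginalAB_bipartiteTensor ρ hρ'.2, marginalPrimed_bipartiteTensor ρ' hρ.2] at h

/-! ### Tensor powers and regularisation -/

theorem bipartiteTensorPower_one {a b : Type*} (ρ : Matrix (a × b) (a × b) ℂ) :
    bipartiteTensorPower ρ 1 = ρ.submatrix
      ((Equiv.funUnique (Fin 1) a).prodCongr (Equiv.funUnique (Fin 1) b))
      ((Equiv.funUnique (Fin 1) a).prodCongr (Equiv.funUnique (Fin 1) b)) := by
  ext ⟨_, _⟩ ⟨_, _⟩
  simp [bipartiteTensorPower]

theorem bipartiteTensorPower_succ {a b : Type*} (ρ : Matrix (a × b) (a × b) ℂ) (n : ℕ) :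
    bipartiteTensorPower ρ (n + 1) = (bipartiteTensor ρ (bipartiteTensorPower ρ n)).submatrix
      ((Fin.consEquiv fun _ => a).symm.prodCongr (Fin.consEquiv fun _ => b).symm)
      ((Fin.consEquiv fun _ => a).symm.prodCongr (Fin.consEquiv fun _ => b).symm) := by
  ext x y
  simp [bipartiteTensorPower, bipartiteTensor, Fin.prod_univ_succ, Fin.consEquiv, Fin.tail]

theorem IsState.bipartiteTensorPower {a b : Type*} [Fintype a] [Fintype b]
    {ρ : Matrix (a × b) (a × b) ℂ} (hρ : IsState ρ) {n : ℕ} (hn : 1 ≤ n) : IsState (bipartiteTensorPower ρ n) := by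
  induction n, hn using Nat.le_induction with
  | base => rw [bipartiteTensorPower_one]; exact hρ.submatrix _
  | succ n _ ih => rw [bipartiteTensorPower_succ]; exact (hρ.bipartiteTensor ih).submatrix _

theorem squashedEntanglement_bipartiteTensorPower {ρ : Matrix (a × b) (a × b) ℂ}
    (hρ : IsState ρ) {n : ℕ} (hn : 1 ≤ n) :
    squashedEntanglement (bipartiteTensorPower ρ n) = n * squashedEntanglement ρ := by
  induction n, hn using Nat.le_induction with
  | base => rw [bipartiteTensorPower_one, squashedEntanglement_submatrix]; simp
  | succ n hn ih =>
    rw [bipartiteTensorPower_succ, squashedEntanglement_submatrix,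
      squashedEntanglement_bipartiteTensor hρ (hρ.bipartiteTensorPower hn), ih]
    push_cast
    ring

theorem squashedEntanglement_bipartiteTensorPower_div {ρ : Matrix (a × b) (a × b) ℂ}
    (hρ : IsState ρ) {n : ℕ} (hn : 1 ≤ n) :
    squashedEntanglement (bipartiteTensorPower ρ n) / (n : ℝ) = squashedEntanglement ρ := by
  have hn' : (n : ℝ) ≠ 0 := by positivity
  rw [squashedEntanglement_bipartiteTensorPower hρ hn, mul_div_cancel_left₀ _ hn']

end Squashed

theorem mainTheorem8 {a a' b b' : Type*}
    [Fintype a] [DecidableEq a] [Fintype a'] [DecidableEq a']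
    [Fintype b] [DecidableEq b] [Fintype b'] [DecidableEq b'] :
    -- the infimum defining squashed entanglement is a genuine (finite) one
    (∀ ρ : Matrix (a × b) (a × b) ℂ, IsState ρ →
      IsGLB (squashedValues ρ) (squashedEntanglement ρ)) ∧
    -- strong superadditivity
    (∀ ρ : Matrix ((a × a') × (b × b')) ((a × a') × (b × b')) ℂ, IsState ρ →
      squashedEntanglement (marginalAB ρ) + squashedEntanglement (marginalPrimed ρ)
        ≤ squashedEntanglement ρ) ∧
    -- subadditivity on tensor products
    (∀ (ρ : Matrix (a × b) (a × b) ℂ) (σ : Matrix (a' × b') (a' × b') ℂ),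
      IsState ρ → IsState σ →
      squashedEntanglement (bipartiteTensor ρ σ)
        ≤ squashedEntanglement ρ + squashedEntanglement σ) ∧
    -- additivity on tensor products
    (∀ (ρ : Matrix (a × b) (a × b) ℂ) (σ : Matrix (a' × b') (a' × b') ℂ),
      IsState ρ → IsState σ →
      squashedEntanglement (bipartiteTensor ρ σ)
        = squashedEntanglement ρ + squashedEntanglement σ) ∧
    -- extensivity
    (∀ ρ : Matrix (a × b) (a × b) ℂ, IsState ρ → ∀ n : ℕ, 1 ≤ n →
      squashedEntanglement ρ = squashedEntanglement (bipartiteTensorPower ρ n) / (n : ℝ)) ∧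
    -- the regularisation exists and coincides with squashed entanglement
    (∀ ρ : Matrix (a × b) (a × b) ℂ, IsState ρ →
      Filter.Tendsto
        (fun n : ℕ => squashedEntanglement (bipartiteTensorPower ρ n) / (n : ℝ))
        Filter.atTop (nhds (squashedEntanglement ρ))) := by
  refine ⟨fun ρ hρ => ?_, fun ρ hρ => ?_, fun ρ σ hρ hσ => ?_, fun ρ σ hρ hσ => ?_,
    fun ρ hρ n hn => ?_, fun ρ hρ => ?_⟩
  · exact isGLB_csInf (squashedValues_nonempty hρ) (squashedValues_bddBelow ρ)
  · exact squashedEntanglement_superadditive hρ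
  · exact squashedEntanglement_bipartiteTensor_le hρ hσ
  · exact squashedEntanglement_bipartiteTensor hρ hσ
  · exact (squashedEntanglement_bipartiteTensorPower_div hρ hn).symm
  -- The sequence is constant from `n = 1` on; at `n = 0` division by zero gives `0`, so equality is
  -- only required eventually.
  · refine tendsto_const_nhds.congr' ?_
    filter_upwards [Filter.eventually_ge_atTop 1] with n hn
    exact (squashedEntanglement_bipartiteTensorPower_div hρ hn).symm
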